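/- Let $n\ge 0$, let $\mathcal X_i,\mathcal Y_i$ ($0\le i\le n$) be Polish spaces with their Borel $\sigma$-algebras, put $\mathcal X_{0,k}=\prod_{i=0}^{k}\mathcal X_i$, $\mathcal Y_{0,k}=\prod_{i=0}^{k}\mathcal Y_i$ (with $\mathcal Y_{0,-1}$ a point), and assume that $\mathcal Y_{0,n}$ is compact. Let $P_{X^n}$ be a Borel probability measure on $\mathcal X_{0,n}$. Let $\mathcal Q(\mathcal Y_{0,n};\mathcal X_{0,n})$ be the set of all stochastic kernels $P(dy^n|x^n)$ on $\mathcal Y_{0,n}$ given $\mathcal X_{0,n}$, with the topology of weak convergence of probability measures: $P_\alpha\to P$ if and only if the joint distributions $P_\alpha(dy^n|x^n)\otimes P_{X^n}(dx^n)$ converge weakly to $P(dy^n|x^n)\otimes P_{X^n}(dx^n)$ on $\mathcal X_{0,n}\times\mathcal Y_{0,n}$ (so kernels that agree $P_{X^n}$-a.s. are not distinguished). Let $\overrightarrow Q_{ad}$ be the set of those $P\in\mathcal Q(\mathcal Y_{0,n};\mathcal X_{0,n})$ for which there are stochastic kernels $q_i(dy_i|y^{i-1},x^i)$ on $\mathcal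 Y_i$ given $\mathcal Y_{0,i-1}\times\mathcal X_{0,i}$, $0\le i\le n$, with $$P(dy^n|x^n)=\bigotimes_{i=0}^n q_i(dy_i|y^{i-1},x^i)\quad\text{for } P_{X^n}\text{-almost every } x^n .$$ 1) $\mathcal Q(\mathcal Y_{0,n};\mathcal X_{0,n})$ is compact, and $\overrightarrow Q_{ad}$ is a closed subset of it, hence compact. 2) Let $\rho_{0,i}:\mathcal X_{0,i}\times\mathcal Y_{0,i}\to[0,\infty)$, $0\le i\le n$, be Borel measurable, let $d_{0,n}(x^n,y^n)=\sum_{i=0}^n\rho_{0,i}(x^i,y^i)$, and let $D\ge 0$. Assume that $d_{0,n}(x^n,\cdot)$ is continuous on $\mathcal Y_{0,n}$ for every $x^n\in\mathcal X_{0,n}$, and that $d_{0,n}(x^n,y^n)<D$ for some $(x^n,y^n)\in\mathcal X_{0,n}\times\mathcal Y_{0,n}$. Then $$\overrightarrow Q_{0,n}(D)=\Big\{P\in\overrightarrow Q_{ad}:\ \int_{\mathcal X_{0,n}\times\mathcal Y_{0,n}} d_{0,n}(x^n,y^n)\,P(dy^n|x^n)\otimes P_{X^n}(dx^n)\le D\Big\}$$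 is a closed subset of $\mathcal Q(\mathcal Y_{0,n};\mathcal X_{0,n})$ contained in $\overrightarrow Q_{ad}$ (hence closed in $\overrightarrow Q_{ad}$), and it is compact. -/

import Mathlib

open MeasureTheory ProbabilityTheory
open scoped NNReal ENNReal

noncomputable section

namespace CausalRDF

/-- `CondDist μ β` is the set of conditional distributions on `β` given an `α`-valued variable of
law `μ`, that is, the set of all stochastic (Markov) kernels from `α` to `β`. The law `μ` enters
only through the topology below. -/
def CondDist {α : Type*} [MeasurableSpace α] (_μ : ProbabilityMeasure α)
    (β : Type*) [MeasurableSpace β] : Type _ :=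
  {κ : Kernel α β // IsMarkovKernel κ}

/-- The joint distribution `P(dy | x) ⊗ μ(dx)` on `α × β`. -/
def CondDist.joint {α β : Type*} [MeasurableSpace α] [MeasurableSpace β]
    {μ : ProbabilityMeasure α} (P : CondDist μ β) : ProbabilityMeasure (α × β) :=
  haveI := P.2
  ⟨(μ : Measure α) ⊗ₘ P.1, inferInstance⟩

/-- The topology of weak convergence of probability measures: `P_a → P` means that the joint
distributions `P_a(dy | x) ⊗ μ(dx)` converge weakly to `P(dy | x) ⊗ μ(dx)`. Kernels that agree
`μ`-almost surely are not separated. -/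
instance {α β : Type*} [TopologicalSpace α] [MeasurableSpace α] [TopologicalSpace β]
    [MeasurableSpace β] [OpensMeasurableSpace (α × β)] (μ : ProbabilityMeasure α) :
    TopologicalSpace (CondDist μ β) :=
  TopologicalSpace.induced CondDist.joint inferInstance

/-- `Seq X k` is the space `X_0 × ⋯ × X_{k-1}` (a one-point space if `k = 0`). -/
abbrev Seq (X : ℕ → Type*) (k : ℕ) : Type _ := (j : Fin k) → X j

/-- The initial segment `(x_0, …, x_{k-1})` of `(x_0, …, x_{m-1})`, where `k ≤ m`. -/
def Seq.restrict {X : ℕ → Type*} {k m : ℕ} (h : k ≤ m) (x : Seq X m) : Seq X k :=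
  fun j => x (Fin.castLE h j)

/-- `((y_0, …, y_{k-1}), y_k) ↦ (y_0, …, y_k)`. -/
def Seq.append {Y : ℕ → Type*} {k : ℕ} (p : Seq Y k × Y k) : Seq Y (k + 1) :=
  Fin.snoc (α := fun j : Fin (k + 1) => Y j) p.1 p.2

theorem Seq.measurable_restrict {X : ℕ → Type*} [∀ i, MeasurableSpace (X i)] {k m : ℕ}
    (h : k ≤ m) : Measurable (Seq.restrict (X := X) h) :=
  measurable_pi_lambda _ fun j => measurable_pi_apply (Fin.castLE h j)

theorem Seq.measurable_append {Y : ℕ → Type*} [∀ i, MeasurableSpace (Y i)] {k : ℕ} :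
    Measurable (Seq.append (Y := Y) (k := k)) := by
  refine measurable_pi_lambda _ fun j => ?_
  refine Fin.lastCases ?_ (fun j => ?_) j
  · simpa [Seq.append] using measurable_snd
  · have h : Measurable fun p : Seq Y k × Y k => p.1 j :=
      (measurable_pi_apply j).comp measurable_fst
    simpa [Seq.append] using h

/-- The causal convolution product `⊗_{i<k} q_i(dy_i | y^{i-1}, x^i)` of kernels
`q_i(dy_i | x^i, y^{i-1})`, where `x^i = (x_0, …, x_i)` and `y^{i-1} = (y_0, …, y_{i-1})`. -/
def causalProduct {X Y : ℕ → Type*} [∀ i, MeasurableSpace (X i)] [∀ i, MeasurableSpace (Y i)] :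
    (k : ℕ) → ((i : Fin k) → Kernel (Seq X (i + 1) × Seq Y i) (Y i)) →
      Kernel (Seq X k) (Seq Y k)
  | 0, _ => Kernel.const _ (Measure.dirac fun j => j.elim0)
  | k + 1, q =>
      (((causalProduct k fun i => q i.castSucc).comap (Seq.restrict k.le_succ)
          (Seq.measurable_restrict k.le_succ)) ⊗ₖ
        (q (Fin.last k) : Kernel (Seq X (k + 1) × Seq Y k) (Y k))).map Seq.append

/-- The realizability constraint set: all conditional distributions of `Y^n` given `X^n` that are
almost surely equal to a causal product of stochastic kernels `q_i(dy_i | y^{i-1}, x^i)`,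
`0 ≤ i ≤ n`. -/
def realizable {X Y : ℕ → Type*} [∀ i, MeasurableSpace (X i)] [∀ i, MeasurableSpace (Y i)]
    {n : ℕ} (μ : ProbabilityMeasure (Seq X (n + 1))) : Set (CondDist μ (Seq Y (n + 1))) :=
  {P | ∃ q : (i : Fin (n + 1)) → Kernel (Seq X (i + 1) × Seq Y i) (Y i),
      (∀ i, IsMarkovKernel (q i)) ∧
        ∀ᵐ x ∂(μ : Measure (Seq X (n + 1))), P.1 x = causalProduct (n + 1) q x}

/-- The distortion `d_{0,n}(x^n, y^n) = ∑_{i=0}^n ρ_{0,i}(x^i, y^i)`. -/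
def distortion {X Y : ℕ → Type*} {n : ℕ}
    (ρ : (i : Fin (n + 1)) → Seq X (i + 1) × Seq Y (i + 1) → ℝ≥0)
    (x : Seq X (n + 1)) (y : Seq Y (n + 1)) : ℝ≥0 :=
  ∑ i : Fin (n + 1), ρ i (Seq.restrict i.isLt x, Seq.restrict i.isLt y)

/-- The realizable conditional distributions whose average distortion
`∫ d_{0,n}(x^n, y^n) P(dy^n | x^n) ⊗ μ(dx^n)` is at most `D`. -/
def fidelity {X Y : ℕ → Type*} [∀ i, MeasurableSpace (X i)] [∀ i, MeasurableSpace (Y i)]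
    {n : ℕ} (μ : ProbabilityMeasure (Seq X (n + 1)))
    (ρ : (i : Fin (n + 1)) → Seq X (i + 1) × Seq Y (i + 1) → ℝ≥0) (D : ℝ≥0) :
    Set (CondDist μ (Seq Y (n + 1))) :=
  {P | ∫⁻ p : Seq X (n + 1) × Seq Y (n + 1), (distortion ρ p.1 p.2 : ℝ≥0∞)
      ∂(P.joint : Measure (Seq X (n + 1) × Seq Y (n + 1))) ≤ D} ∩ realizable μ

end CausalRDF

end

namespace CausalRDF

open Topology Filter BoundedContinuousFunction

/-! By disintegration, conditional distributions correspond to joint laws with first marginal `μ`.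
These form a closed set, tight because `μ` is tight and the second factor compact, so Prokhorov
gives compactness (`CondDist.isCompact_univ`).

Realizability is an almost-sure factorization, not visibly stable under weak limits. It is
equivalent to conditional independences: for each `k`, `y^{k-1}` is independent of `x^n` given
`x^{k-1}` (`mem_realizable_iff`). Let `ν k` be the conditional law of `x^n` given `x^{k-1}`. It
depends on `μ` alone, so the condition reads: the law of `(x^n, y^{k-1})` equals the `glue` of `ν k`
with the law of `(x^{k-1}, y^{k-1})`. Both sides are continuous in `P`. For the glued side the
integrands are only measurable in `x`, though continuous in `y`; since the first marginal is fixed,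
`CondDist.continuous_integral` still applies.

The same lemma, applied to truncations of the distortion, makes the average distortion a supremum of
continuous functions, so its sublevel sets are closed. -/

/-- On a compact metrizable space `β`, a map into `C(β, ℝ)` is strongly measurable as soon as all
its evaluations are measurable. -/
theorem stronglyMeasurable_continuousMap {α β : Type*} [MeasurableSpace α]
    [TopologicalSpace β] [PolishSpace β] [CompactSpace β] {h : α → C(β, ℝ)}
    (hh : ∀ y, Measurable fun x => h x y) : StronglyMeasurable h := by
  borelize C(β, ℝ)
  rcases isEmpty_or_nonempty β with hβ | hβ
  · have : h = fun _ => 0 := by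
      funext x; ext y; exact hβ.elim y
    rw [this]; exact stronglyMeasurable_const
  · let e : C(β, ℝ) → ℕ → ℝ := fun f k => f (TopologicalSpace.denseSeq β k)
    have he : Continuous e := continuous_pi fun k => continuous_eval_const _
    have hinj : Function.Injective e := fun f g hfg => by
      refine DFunLike.coe_injective
        ((TopologicalSpace.denseRange_denseSeq β).equalizer f.continuous g.continuous ?_)
      exact hfg
    -- Lusin–Souslin: a continuous injection of the Polish space `C(β, ℝ)` is a Borel embedding.
    have hem : MeasurableEmbedding e := he.measurableEmbedding hinj
    have : Measurable h := hem.measurable_comp_iff.1 (measurable_pi_lambda _ fun k => hh _)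
    exact this.stronglyMeasurable

/-! ### Compactness and continuity for weak convergence with fixed first marginal -/

theorem CondDist.isInducing_joint {α β : Type*} [TopologicalSpace α] [MeasurableSpace α]
    [TopologicalSpace β] [MeasurableSpace β] [OpensMeasurableSpace (α × β)]
    {μ : ProbabilityMeasure α} :
    IsInducing (CondDist.joint : CondDist μ β → ProbabilityMeasure (α × β)) := ⟨rfl⟩

theorem CondDist.map_fst_joint {α β : Type*} [MeasurableSpace α] [MeasurableSpace β]
    {μ : ProbabilityMeasure α} (P : CondDist μ β) :
    (P.joint : Measure (α × β)).map Prod.fst = μ := by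
  have := P.2
  exact Measure.fst_compProd (μ : Measure α) P.1

theorem CondDist.range_joint {α β : Type*} [MeasurableSpace α] [MeasurableSpace β]
    [StandardBorelSpace β] [Nonempty β] {μ : ProbabilityMeasure α} :
    Set.range (CondDist.joint : CondDist μ β → ProbabilityMeasure (α × β)) =
      {ν | ν.map measurable_fst.aemeasurable = μ} := by
  ext ν
  constructor
  · rintro ⟨P, rfl⟩
    exact Subtype.ext P.map_fst_joint
  · intro hν
    have h1 : (ν : Measure (α × β)).fst = μ := congrArg Subtype.val hν
    refine ⟨⟨(ν : Measure (α × β)).condKernel, inferInstance⟩, Subtype.ext ?_⟩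
    change (μ : Measure α) ⊗ₘ (ν : Measure (α × β)).condKernel = ν
    rw [← h1]
    exact (ν : Measure (α × β)).disintegrate _

section CondDist

variable {α β : Type*} [TopologicalSpace α] [PolishSpace α] [MeasurableSpace α] [BorelSpace α]
  [TopologicalSpace β] [PolishSpace β] [MeasurableSpace β] [BorelSpace β]
  {μ : ProbabilityMeasure α}

theorem CondDist.isCompact_univ [CompactSpace β] :
    IsCompact (Set.univ : Set (CondDist μ β)) := by
  -- Disintegration needs `β` nonempty; over an empty `β` there are no Markov kernels, since `μ` has
  -- mass one.
  rcases isEmpty_or_nonempty β with hβ | hβ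
  · have : IsEmpty (CondDist μ β) := ⟨fun P => by
      obtain ⟨p⟩ := P.joint.nonempty
      exact hβ.elim p.2⟩
    rw [Set.univ_eq_empty_iff.2 this]
    exact isCompact_empty
  rw [CondDist.isInducing_joint.isCompact_iff, Set.image_univ, CondDist.range_joint]
  set S : Set (ProbabilityMeasure (α × β)) := {ν | ν.map measurable_fst.aemeasurable = μ}
  have hclosed : IsClosed S :=
    isClosed_eq (ProbabilityMeasure.continuous_map continuous_fst) continuous_const
  let _ := TopologicalSpace.upgradeIsCompletelyMetrizable α
  let _ := TopologicalSpace.upgradeIsCompletelyMetrizable β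
  have htight : IsTightMeasureSet {((ν : ProbabilityMeasure (α × β)) : Measure (α × β)) | ν ∈ S} := by
    rw [isTightMeasureSet_iff_exists_isCompact_measure_compl_le]
    intro ε hε
    obtain ⟨K, hK, hKε⟩ := isTightMeasureSet_iff_exists_isCompact_measure_compl_le.1
      (isTightMeasureSet_singleton (μ := (μ : Measure α))) ε hε
    refine ⟨K ×ˢ Set.univ, hK.prod CompactSpace.isCompact_univ, ?_⟩
    rintro _ ⟨ν, hν, rfl⟩
    have h1 : (ν : Measure (α × β)).map Prod.fst = μ := congrArg Subtype.val hν
    have h2 : (K ×ˢ (Set.univ : Set β))ᶜ = Prod.fst ⁻¹' Kᶜ := by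
      ext p; simp
    rw [h2, ← Measure.map_apply measurable_fst hK.isClosed.measurableSet.compl, h1]
    exact hKε _ rfl
  have := isCompact_closure_of_isTightMeasureSet htight
  rwa [hclosed.closure_eq] at this

/-- Integrals of bounded functions that are measurable in the first and continuous in the second
variable are continuous for weak convergence with a fixed first marginal. -/
theorem CondDist.continuous_integral [CompactSpace β] {h : α × β → ℝ} (hm : Measurable h)
    (hc : ∀ x, Continuous fun y => h (x, y)) {C : ℝ} (hC : ∀ p, |h p| ≤ C) :
    Continuous fun P : CondDist μ β => ∫ p, h p ∂(P.joint : Measure (α × β)) := by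
  let H : α → C(β, ℝ) := fun x => ⟨fun y => h (x, y), hc x⟩
  have hH : StronglyMeasurable H := stronglyMeasurable_continuousMap fun y =>
    hm.comp measurable_prodMk_right
  have hHi : Integrable H (μ : Measure α) := by
    refine Integrable.of_bound hH.aestronglyMeasurable (max C 0) (ae_of_all _ fun x => ?_)
    exact (ContinuousMap.norm_le _ (le_max_right _ _)).2 fun y => (hC (x, y)).trans (le_max_left _ _)
  rw [← continuousOn_univ]
  refine continuousOn_of_uniform_approx_of_continuousOn fun u hu => ?_
  obtain ⟨ε, hε, hεu⟩ := Metric.mem_uniformity_dist.1 hu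
  let _ := TopologicalSpace.upgradeIsCompletelyMetrizable α
  -- Approximation in `L¹(μ; C(β, ℝ))`. The error is bounded by a function of `x` alone, whose
  -- integral sees only `μ`, hence is uniform in `P`.
  obtain ⟨g, hg, hgi⟩ := hHi.exists_boundedContinuous_integral_sub_le (half_pos hε)
  let G : (α × β) →ᵇ ℝ := BoundedContinuousFunction.ofNormedAddCommGroup
    (fun p : α × β => g p.1 p.2) (by fun_prop) ‖g‖ fun p =>
      ((g p.1).norm_coe_le_norm p.2).trans (g.norm_coe_le_norm p.1)
  refine ⟨fun P => ∫ p, G p ∂(P.joint : Measure (α × β)), ?_, fun P _ => hεu ?_⟩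
  · exact ((ProbabilityMeasure.continuous_integral_boundedContinuousFunction G).comp
      CondDist.isInducing_joint.continuous).continuousOn
  have h1 : Integrable h (P.joint : Measure (α × β)) :=
    Integrable.of_bound hm.aestronglyMeasurable C (ae_of_all _ hC)
  have h2 : Integrable G (P.joint : Measure (α × β)) := G.integrable _
  rw [Real.dist_eq, ← integral_sub h1 h2]
  have hm' : MeasurePreserving Prod.fst (P.joint : Measure (α × β)) (μ : Measure α) :=
    ⟨measurable_fst, P.map_fst_joint⟩
  have h3 : Integrable (fun x => ‖H x - g x‖) (μ : Measure α) := (hHi.sub hgi).norm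
  have h4 : Integrable (fun p : α × β => ‖H p.1 - g p.1‖) (P.joint : Measure (α × β)) :=
    hm'.integrable_comp_of_integrable h3
  calc |∫ p, (h p - G p) ∂(P.joint : Measure (α × β))|
      ≤ ∫ p, ‖H p.1 - g p.1‖ ∂(P.joint : Measure (α × β)) := by
        rw [← Real.norm_eq_abs]
        refine norm_integral_le_of_norm_le h4 (ae_of_all _ fun p => ?_)
        exact ContinuousMap.norm_coe_le_norm (H p.1 - g p.1) p.2
    _ = ∫ x, ‖H x - g x‖ ∂(μ : Measure α) := by
        rw [← P.map_fst_joint, integral_map measurable_fst.aemeasurable]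
        rw [P.map_fst_joint]; exact h3.aestronglyMeasurable
    _ ≤ ε / 2 := hg
    _ < ε := half_lt_self hε

end CondDist

/-! ### Conditional independence as a gluing identity -/

/-- Given a law `l` of `(u, y)` and a kernel `ν(dx | u)`, the law of `(x, y)` when `x` is drawn
from `ν(· | u)` independently of `y` given `u`. -/
noncomputable def glue {α γ δ : Type*} [MeasurableSpace α] [MeasurableSpace γ] [MeasurableSpace δ]
    (ν : Kernel γ α) (l : Measure (γ × δ)) : Measure (α × δ) :=
  (l ⊗ₘ ν.comap Prod.fst measurable_fst).map fun p => (p.2, p.1.2)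

section Glue

variable {α γ δ : Type*} [MeasurableSpace α] [MeasurableSpace γ] [MeasurableSpace δ]

theorem measurable_glue_fun : Measurable fun p : (γ × δ) × α => (p.2, p.1.2) := by fun_prop

instance isProbabilityMeasure_glue (ν : Kernel γ α) [IsMarkovKernel ν] (l : Measure (γ × δ))
    [IsProbabilityMeasure l] : IsProbabilityMeasure (glue ν l) :=
  Measure.isProbabilityMeasure_map measurable_glue_fun.aemeasurable

theorem lintegral_glue (ν : Kernel γ α) [IsMarkovKernel ν] (l : Measure (γ × δ)) [SFinite l]
    {f : α × δ → ℝ≥0∞} (hf : Measurable f) :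
    ∫⁻ p, f p ∂(glue ν l) = ∫⁻ p, ∫⁻ x, f (x, p.2) ∂(ν p.1) ∂l := by
  rw [glue, lintegral_map hf measurable_glue_fun,
    Measure.lintegral_compProd (by fun_prop)]
  rfl

theorem integral_glue (ν : Kernel γ α) [IsMarkovKernel ν] (l : Measure (γ × δ))
    [IsProbabilityMeasure l] {f : α × δ → ℝ} (hf : Measurable f) {C : ℝ} (hC : ∀ p, |f p| ≤ C) :
    ∫ p, f p ∂(glue ν l) = ∫ p, ∫ x, f (x, p.2) ∂(ν p.1) ∂l := by
  rw [glue, integral_map measurable_glue_fun.aemeasurable hf.aestronglyMeasurable,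
    Measure.integral_compProd]
  · rfl
  · exact Integrable.of_bound (hf.comp measurable_glue_fun).aestronglyMeasurable C
      (ae_of_all _ fun p => hC _)

/-- `hν` makes `ν` the conditional law of `x` given `r x`. When `y` depends on `x` only through `r
x`, Tonelli lets `x` and `y` be drawn in either order given `r x`. -/
theorem glue_compProd {μ : Measure α} [IsProbabilityMeasure μ] {r : α → γ} (hr : Measurable r)
    {ν : Kernel γ α} [IsMarkovKernel ν] (hν : μ.map r ⊗ₘ ν = μ.map fun x => (r x, x))
    (κ : Kernel γ δ) [IsMarkovKernel κ] :
    glue ν (μ.map r ⊗ₘ κ) = μ ⊗ₘ κ.comap r hr := by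
  have : IsProbabilityMeasure (μ.map r) := Measure.isProbabilityMeasure_map hr.aemeasurable
  refine Measure.ext_of_lintegral _ fun f hf => ?_
  have h1 : Measurable fun p : (γ × δ) => ∫⁻ x, f (x, p.2) ∂(ν p.1) :=
    Measurable.lintegral_kernel_prod_right' (κ := ν.comap Prod.fst measurable_fst)
      (hf.comp measurable_glue_fun)
  have h2 : Measurable fun p : (γ × α) => ∫⁻ y, f (p.2, y) ∂(κ p.1) :=
    Measurable.lintegral_kernel_prod_right' (κ := κ.comap Prod.fst measurable_fst)
      (f := fun q : (γ × α) × δ => f (q.1.2, q.2)) (by fun_prop)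
  rw [lintegral_glue _ _ hf, Measure.lintegral_compProd h1, Measure.lintegral_compProd hf]
  calc ∫⁻ u, ∫⁻ y, ∫⁻ x, f (x, y) ∂(ν u) ∂(κ u) ∂(μ.map r)
      = ∫⁻ u, ∫⁻ x, ∫⁻ y, f (x, y) ∂(κ u) ∂(ν u) ∂(μ.map r) := by
        refine lintegral_congr fun u => ?_
        exact lintegral_lintegral_swap (hf.comp measurable_swap).aemeasurable
    _ = ∫⁻ p, ∫⁻ y, f (p.2, y) ∂(κ p.1) ∂(μ.map r ⊗ₘ ν) := (Measure.lintegral_compProd h2).symm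
    _ = ∫⁻ x, ∫⁻ y, f (x, y) ∂(κ.comap r hr x) ∂μ := by
        rw [hν, lintegral_map h2 (by fun_prop)]
        rfl

theorem map_compProd_comap {μ : Measure α} [SFinite μ] {r : α → γ} (hr : Measurable r)
    (κ : Kernel γ δ) [IsSFiniteKernel κ] :
    (μ ⊗ₘ κ.comap r hr).map (Prod.map r id) = μ.map r ⊗ₘ κ := by
  refine Measure.ext_of_lintegral _ fun f hf => ?_
  rw [lintegral_map hf (by fun_prop), Measure.lintegral_compProd (by fun_prop),
    Measure.lintegral_compProd hf, lintegral_map (by fun_prop) hr]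
  rfl

/-- If the law of `(x, y)` disintegrates through `r`, then `x` and `y` are conditionally
independent given `r x`. -/
theorem eq_glue_of_eq_compProd_comap {β : Type*} [MeasurableSpace β] {μ : Measure α}
    [IsProbabilityMeasure μ] {r : α → γ} (hr : Measurable r) {s : β → δ} (hs : Measurable s)
    {ν : Kernel γ α} [IsMarkovKernel ν] (hν : μ.map r ⊗ₘ ν = μ.map fun x => (r x, x))
    {ρ : Measure (α × β)} (κ : Kernel γ δ) [IsMarkovKernel κ]
    (h : ρ.map (Prod.map id s) = μ ⊗ₘ κ.comap r hr) :
    ρ.map (Prod.map id s) = glue ν (ρ.map (Prod.map r s)) := by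
  have h1 : ρ.map (Prod.map r s) = (ρ.map (Prod.map id s)).map (Prod.map r id) := by
    rw [Measure.map_map (by fun_prop) (by fun_prop)]; rfl
  rw [h1, h, map_compProd_comap, glue_compProd hr hν]

end Glue

/-- Conditional independence of `x` and `s y` given `r x` is a closed condition on the conditional
distribution of `y` given `x`. -/
theorem CondDist.isClosed_setOf_eq_glue {α β γ δ : Type*}
    [TopologicalSpace α] [PolishSpace α] [MeasurableSpace α] [BorelSpace α]
    [TopologicalSpace β] [PolishSpace β] [CompactSpace β] [MeasurableSpace β] [BorelSpace β]
    [TopologicalSpace δ] [PolishSpace δ] [MeasurableSpace δ] [BorelSpace δ]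
    [MeasurableSpace γ] {μ : ProbabilityMeasure α} {r : α → γ} (hr : Measurable r)
    {s : β → δ} (hs : Continuous s) (ν : Kernel γ α) [IsMarkovKernel ν] :
    IsClosed {P : CondDist μ β | (P.joint : Measure (α × β)).map (Prod.map id s) =
      glue ν ((P.joint : Measure (α × β)).map (Prod.map r s))} := by
  have hsm : Measurable s := hs.measurable
  have h1 : Continuous fun P : CondDist μ β =>
      P.joint.map (f := Prod.map id s) (by fun_prop : Measurable _).aemeasurable :=
    (ProbabilityMeasure.continuous_map (by fun_prop)).comp CondDist.isInducing_joint.continuous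
  have hp (P : CondDist μ β) :
      IsProbabilityMeasure ((P.joint : Measure (α × β)).map (Prod.map r s)) :=
    Measure.isProbabilityMeasure_map (by fun_prop)
  let G (P : CondDist μ β) : ProbabilityMeasure (α × δ) :=
    ⟨glue ν ((P.joint : Measure (α × β)).map (Prod.map r s)), inferInstance⟩
  have h2 : Continuous G := by
    rw [ProbabilityMeasure.continuous_iff_forall_continuous_integral]
    intro F
    have hF (p : α × δ) : |F p| ≤ ‖F‖ := F.norm_coe_le_norm p
    have hFm : Measurable F := F.continuous.measurable
    have hm : Measurable fun p : γ × δ => ∫ x, F (x, p.2) ∂(ν p.1) :=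
      (StronglyMeasurable.integral_kernel_prod_right' (κ := ν.comap Prod.fst measurable_fst)
        (hFm.comp measurable_glue_fun).stronglyMeasurable).measurable
    have h3 : ∀ P : CondDist μ β, ∫ p, F p ∂(glue ν ((P.joint : Measure (α × β)).map
        (Prod.map r s))) = ∫ p, ∫ x, F (x, s p.2) ∂(ν (r p.1)) ∂(P.joint : Measure (α × β)) := by
      intro P
      rw [integral_glue ν _ hFm hF, integral_map (by fun_prop) hm.aestronglyMeasurable]
      rfl
    simp only [G, ProbabilityMeasure.coe_mk, h3]
    -- Averaging `F` over `ν (r x)` keeps continuity in `y` by dominated convergence; in `x` only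
    -- measurability survives.
    refine CondDist.continuous_integral (C := ‖F‖) (hm.comp (by fun_prop : Measurable (Prod.map r s)))
      (fun x => ?_) fun p => ?_
    · change Continuous fun y => ∫ x', F (x', s y) ∂(ν (r x))
      refine continuous_of_dominated (bound := fun _ => ‖F‖) (fun y => ?_) (fun y => ?_)
        (integrable_const _) (ae_of_all _ fun x' => by fun_prop)
      · exact (hFm.comp measurable_prodMk_right).aestronglyMeasurable
      · exact ae_of_all _ fun x' => hF _
    · change ‖∫ x', F (x', s p.2) ∂(ν (r p.1))‖ ≤ ‖F‖
      refine (norm_integral_le_of_norm_le_const (C := ‖F‖) (ae_of_all _ fun x => hF _)).trans ?_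
      simp
  convert isClosed_eq h1 h2 using 3 with P
  exact (Subtype.ext_iff (a1 := P.joint.map (f := Prod.map id s) _) (a2 := G P)).symm

/-! ### Causal products and their conditional independences -/

theorem Seq.restrict_append {Y : ℕ → Type*} {k m : ℕ} (h : k ≤ m) (p : Seq Y m × Y m) :
    Seq.restrict (h.trans m.le_succ) (Seq.append p) = Seq.restrict h p.1 := by
  funext j
  exact Fin.snoc_castSucc (α := fun j : Fin (m + 1) => Y j) p.2 p.1 (Fin.castLE h j)

theorem Seq.append_restrict {Y : ℕ → Type*} {k m : ℕ} (h : k + 1 ≤ m) (y : Seq Y m) :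
    Seq.append (Seq.restrict (k.le_succ.trans h) y, y ⟨k, h⟩) = Seq.restrict h y := by
  funext j
  refine Fin.lastCases ?_ (fun j => ?_) j
  · exact Fin.snoc_last (α := fun j : Fin (k + 1) => Y j) _ _
  · exact Fin.snoc_castSucc (α := fun j : Fin (k + 1) => Y j) _ _ j

theorem map_map_compProd_eq_map {α β γ δ ε : Type*} [MeasurableSpace α] [MeasurableSpace β]
    [MeasurableSpace γ] [MeasurableSpace δ] [MeasurableSpace ε] (κ : Kernel α β)
    [IsSFiniteKernel κ] (η : Kernel (α × β) γ) [IsMarkovKernel η] {f : β × γ → δ}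
    (hf : Measurable f) {g : δ → ε} (hg : Measurable g) {g' : β → ε} (hg' : Measurable g')
    (h : g ∘ f = g' ∘ Prod.fst) : ((κ ⊗ₖ η).map f).map g = κ.map g' := by
  rw [← Kernel.map_comp_right _ hf hg, h, Kernel.map_comp_right _ measurable_fst hg',
    ← Kernel.fst_eq, Kernel.fst_compProd]

section Causal

variable {X Y : ℕ → Type*} [∀ i, MeasurableSpace (X i)] [∀ i, MeasurableSpace (Y i)]

theorem isMarkovKernel_causalProduct (k : ℕ)
    (q : (i : Fin k) → Kernel (Seq X (i + 1) × Seq Y i) (Y i)) (hq : ∀ i, IsMarkovKernel (q i)) :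
    IsMarkovKernel (causalProduct k q) := by
  induction k with
  | zero => rw [causalProduct]; infer_instance
  | succ k ih =>
    have := ih (fun i => q i.castSucc) fun i => hq i.castSucc
    have := hq (Fin.last k)
    rw [causalProduct]
    exact Kernel.IsMarkovKernel.map _ Seq.measurable_append

/-- Forgetting the last coordinates integrates out Markov factors, each of mass one; the remaining
factors see only the first `k` inputs. -/
theorem exists_map_restrict_causalProduct {k m : ℕ} (h : k ≤ m)
    (q : (i : Fin m) → Kernel (Seq X (i + 1) × Seq Y i) (Y i)) (hq : ∀ i, IsMarkovKernel (q i)) :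
    ∃ κ : Kernel (Seq X k) (Seq Y k), IsMarkovKernel κ ∧
      (causalProduct m q).map (Seq.restrict h) =
        κ.comap (Seq.restrict h) (Seq.measurable_restrict h) := by
  induction m, h using Nat.le_induction with
  | base =>
    refine ⟨causalProduct k q, isMarkovKernel_causalProduct k q hq, ?_⟩
    exact Kernel.map_id _
  | succ m h ih =>
    obtain ⟨κ, hκ, he⟩ := ih (fun i => q i.castSucc) fun i => hq i.castSucc
    refine ⟨κ, hκ, ?_⟩
    have := isMarkovKernel_causalProduct m (fun i => q i.castSucc) fun i => hq i.castSucc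
    have := hq (Fin.last m)
    have h1 : Seq.restrict (X := Y) (h.trans m.le_succ) ∘ Seq.append =
        Seq.restrict h ∘ Prod.fst := funext fun p => Seq.restrict_append h p
    refine (map_map_compProd_eq_map _ _ Seq.measurable_append (Seq.measurable_restrict _)
      (Seq.measurable_restrict h) h1).trans ?_
    ext x : 1
    rw [Kernel.map_apply _ (Seq.measurable_restrict _), Kernel.comap_apply, Kernel.comap_apply,
      ← Kernel.map_apply _ (Seq.measurable_restrict _), he]
    rfl

/-- A law of `(x, y)`, `y = (y_0, …, y_k)`, whose marginal on `(x, (y_0, …, y_{k-1}))` is given by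
a causal product is itself given by a causal product with one more factor. -/
theorem exists_causalProduct_succ {k : ℕ} [StandardBorelSpace (Y k)] [Nonempty (Y k)]
    (q : (i : Fin k) → Kernel (Seq X (i + 1) × Seq Y i) (Y i)) (hq : ∀ i, IsMarkovKernel (q i))
    {μ : Measure (Seq X (k + 1))} [IsProbabilityMeasure μ]
    {ρ : Measure ((Seq X (k + 1) × Seq Y k) × Y k)} [IsProbabilityMeasure ρ]
    (hρ : ρ.fst = μ ⊗ₘ (causalProduct k q).comap (Seq.restrict k.le_succ)
      (Seq.measurable_restrict k.le_succ)) :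
    ∃ q' : (i : Fin (k + 1)) → Kernel (Seq X (i + 1) × Seq Y i) (Y i),
      (∀ i, IsMarkovKernel (q' i)) ∧
      ρ.map (fun p => (p.1.1, Seq.append (p.1.2, p.2))) = μ ⊗ₘ causalProduct (k + 1) q' := by
  have := isMarkovKernel_causalProduct k q hq
  -- The new factor is the conditional law of `y_k` given `(x^k, y^{k-1})` under `ρ`.
  let q' : (i : Fin (k + 1)) → Kernel (Seq X (i + 1) × Seq Y i) (Y i) :=
    Fin.snoc (α := fun i : Fin (k + 1) => Kernel (Seq X (i + 1) × Seq Y i) (Y i)) q ρ.condKernel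
  have hc (i : Fin k) : q' i.castSucc = q i :=
    Fin.snoc_castSucc (α := fun i : Fin (k + 1) => Kernel (Seq X (i + 1) × Seq Y i) (Y i)) _ _ i
  have hl : q' (Fin.last k) = ρ.condKernel :=
    Fin.snoc_last (α := fun i : Fin (k + 1) => Kernel (Seq X (i + 1) × Seq Y i) (Y i)) _ _
  refine ⟨q', fun i => ?_, ?_⟩
  · refine Fin.lastCases ?_ (fun i => ?_) i
    · rw [hl]; exact inferInstanceAs (IsMarkovKernel ρ.condKernel)
    · rw [hc]; exact hq i
  · have h1 : (fun i : Fin k => q' i.castSucc) = q := funext hc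
    rw [causalProduct, h1, hl, Measure.compProd_map Seq.measurable_append,
      ← Measure.compProd_assoc', ← hρ, ρ.disintegrate, Measure.map_map]
    · rfl
    · exact measurable_id.prodMap Seq.measurable_append
    · exact MeasurableEquiv.measurable _

/-- A conditional distribution is realizable iff for every `k` the variables `x^n` and `y^{k-1}`
are conditionally independent given `x^{k-1}`. -/
theorem mem_realizable_iff [∀ i, StandardBorelSpace (Y i)] {n : ℕ}
    {μ : ProbabilityMeasure (Seq X (n + 1))} [Nonempty (Seq Y (n + 1))]
    {ν : (k : ℕ) → Kernel (Seq X k) (Seq X (n + 1))} [∀ k, IsMarkovKernel (ν k)]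
    (hν : ∀ k (hk : k ≤ n + 1), (μ : Measure (Seq X (n + 1))).map (Seq.restrict hk) ⊗ₘ ν k =
      (μ : Measure (Seq X (n + 1))).map fun x => (Seq.restrict hk x, x))
    (P : CondDist μ (Seq Y (n + 1))) :
    P ∈ realizable μ ↔ ∀ k (hk : k ≤ n + 1),
      (P.joint : Measure (Seq X (n + 1) × Seq Y (n + 1))).map (Prod.map id (Seq.restrict hk)) =
        glue (ν k) ((P.joint : Measure (Seq X (n + 1) × Seq Y (n + 1))).map
          (Prod.map (Seq.restrict hk) (Seq.restrict hk))) := by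
  have hP := P.2
  have hrX {k m : ℕ} (h : k ≤ m) := Seq.measurable_restrict (X := X) h
  have hrY {k m : ℕ} (h : k ≤ m) := Seq.measurable_restrict (X := Y) h
  have hj : (P.joint : Measure (Seq X (n + 1) × Seq Y (n + 1))) =
    (μ : Measure (Seq X (n + 1))) ⊗ₘ P.1 := rfl
  constructor
  · rintro ⟨q, hq, hPq⟩ k hk
    have := isMarkovKernel_causalProduct (n + 1) q hq
    obtain ⟨κ, hκ, he⟩ := exists_map_restrict_causalProduct hk q hq
    refine eq_glue_of_eq_compProd_comap (hrX hk) (hrY hk) (hν k hk) κ ?_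
    rw [hj, Measure.compProd_congr hPq, ← he, Measure.compProd_map (hrY hk)]
  · intro h
    have key : ∀ k (hk : k ≤ n + 1), ∃ q : (i : Fin k) → Kernel (Seq X (i + 1) × Seq Y i) (Y i),
        (∀ i, IsMarkovKernel (q i)) ∧
        (P.joint : Measure (Seq X (n + 1) × Seq Y (n + 1))).map (Prod.map id (Seq.restrict hk)) =
          (μ : Measure (Seq X (n + 1))) ⊗ₘ
            (causalProduct k q).comap (Seq.restrict hk) (hrX hk) := by
      intro k
      induction k with
      | zero =>
        intro hk
        refine ⟨fun i => i.elim0, fun i => i.elim0, ?_⟩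
        have h1 : (causalProduct (X := X) (Y := Y) 0 fun i => i.elim0).comap (Seq.restrict hk)
            (hrX hk) = P.1.map (Seq.restrict hk) := by
          ext x : 1
          have : IsProbabilityMeasure (P.1.map (Seq.restrict hk) x) :=
            (Kernel.IsMarkovKernel.map P.1 (hrY hk)).isProbabilityMeasure x
          rw [causalProduct, Kernel.comap_apply, Kernel.const_apply]
          -- `Seq Y 0` is a single point, so it carries only one probability measure.
          ext s
          refine Subsingleton.set_cases (by simp) ?_ s
          rw [measure_univ, measure_univ]
        rw [h1, Measure.compProd_map (hrY hk), hj]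
      | succ k ih =>
        intro hk
        have hk' : k ≤ n + 1 := k.le_succ.trans hk
        obtain ⟨q, hq, hM⟩ := ih hk'
        have := isMarkovKernel_causalProduct k q hq
        have : Nonempty (Y k) := (‹Nonempty (Seq Y (n + 1))›).map fun y => y ⟨k, hk⟩
        have hf : Measurable fun p : Seq X (n + 1) × Seq Y (n + 1) =>
            ((Seq.restrict hk p.1, Seq.restrict hk' p.2), p.2 ⟨k, hk⟩) :=
          (((hrX hk).comp measurable_fst).prodMk ((hrY hk').comp measurable_snd)).prodMk
            ((measurable_pi_apply (⟨k, hk⟩ : Fin (n + 1))).comp measurable_snd)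
        have hg : Measurable fun p : (Seq X (k + 1) × Seq Y k) × Y k =>
            (p.1.1, Seq.append (p.1.2, p.2)) :=
          (measurable_fst.comp measurable_fst).prodMk (Seq.measurable_append.comp (by fun_prop))
        have : IsProbabilityMeasure ((P.joint : Measure (Seq X (n + 1) × Seq Y (n + 1))).map
            fun p => ((Seq.restrict hk p.1, Seq.restrict hk' p.2), p.2 ⟨k, hk⟩)) :=
          Measure.isProbabilityMeasure_map hf.aemeasurable
        have : IsProbabilityMeasure ((μ : Measure (Seq X (n + 1))).map (Seq.restrict hk)) :=
          Measure.isProbabilityMeasure_map (hrX hk).aemeasurable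
        have hfst : ((P.joint : Measure (Seq X (n + 1) × Seq Y (n + 1))).map
            fun p => ((Seq.restrict hk p.1, Seq.restrict hk' p.2), p.2 ⟨k, hk⟩)).fst =
            (μ : Measure (Seq X (n + 1))).map (Seq.restrict hk) ⊗ₘ
              (causalProduct k q).comap (Seq.restrict k.le_succ) (hrX k.le_succ) := by
          rw [← map_compProd_comap (hrX hk), Measure.fst, Measure.map_map measurable_fst hf]
          change _ = Measure.map _ ((μ : Measure (Seq X (n + 1))) ⊗ₘ
            (causalProduct k q).comap (Seq.restrict hk') (hrX hk'))
          rw [← hM, Measure.map_map ((hrX hk).prodMap measurable_id)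
            (measurable_id.prodMap (hrY hk'))]
          rfl
        obtain ⟨q', hq', he⟩ := exists_causalProduct_succ q hq hfst
        have := isMarkovKernel_causalProduct (k + 1) q' hq'
        refine ⟨q', hq', ?_⟩
        -- Independence at level `k + 1` reduces the law of `(x^n, y^k)` to that of `(x^k, y^k)`,
        -- where `he` supplies the factor `q_k`; `glue_compProd` then lifts the product back to
        -- `x^n`.
        rw [h (k + 1) hk, ← glue_compProd (hrX hk) (hν _ hk), ← he, Measure.map_map hg hf]
        congr 2
        funext p
        exact Prod.ext rfl (Seq.append_restrict hk p.2).symm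
    obtain ⟨q, hq, he⟩ := key (n + 1) le_rfl
    have := isMarkovKernel_causalProduct (n + 1) q hq
    refine ⟨q, hq, Kernel.ae_eq_of_compProd_eq ?_⟩
    exact Measure.map_id.symm.trans he

end Causal

/-! ### Closedness of the constraint sets -/

theorem isClosed_realizable {X Y : ℕ → Type*}
    [∀ i, TopologicalSpace (X i)] [∀ i, PolishSpace (X i)]
    [∀ i, MeasurableSpace (X i)] [∀ i, BorelSpace (X i)]
    [∀ i, TopologicalSpace (Y i)] [∀ i, PolishSpace (Y i)]
    [∀ i, MeasurableSpace (Y i)] [∀ i, BorelSpace (Y i)]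
    {n : ℕ} {μ : ProbabilityMeasure (Seq X (n + 1))} [CompactSpace (Seq Y (n + 1))] :
    IsClosed (realizable (Y := Y) μ) := by
  rcases isEmpty_or_nonempty (Seq Y (n + 1)) with hY | hY
  · have : realizable (Y := Y) μ = ∅ := Set.eq_empty_of_forall_notMem fun P _ => by
      obtain ⟨p⟩ := P.joint.nonempty
      exact hY.elim p.2
    rw [this]
    exact isClosed_empty
  have hX : Nonempty (Seq X (n + 1)) := μ.nonempty
  have hex (k : ℕ) : ∃ ν : Kernel (Seq X k) (Seq X (n + 1)), IsMarkovKernel ν ∧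
      ∀ hk : k ≤ n + 1, (μ : Measure (Seq X (n + 1))).map (Seq.restrict hk) ⊗ₘ ν =
        (μ : Measure (Seq X (n + 1))).map fun x => (Seq.restrict hk x, x) := by
    by_cases hk : k ≤ n + 1
    · exact ⟨condDistrib id (Seq.restrict hk) μ, inferInstance,
        fun _ => compProd_map_condDistrib aemeasurable_id⟩
    · obtain ⟨x⟩ := hX
      -- An arbitrary Markov kernel for the levels `k > n + 1`, on which no condition is imposed.
      exact ⟨Kernel.const _ (Measure.dirac x), inferInstance, fun h => absurd h hk⟩
  choose ν hνm hν using hex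
  have : realizable (Y := Y) μ = ⋂ (k : ℕ) (hk : k ≤ n + 1), {P : CondDist μ (Seq Y (n + 1)) |
      (P.joint : Measure (Seq X (n + 1) × Seq Y (n + 1))).map (Prod.map id (Seq.restrict hk)) =
        glue (ν k) ((P.joint : Measure (Seq X (n + 1) × Seq Y (n + 1))).map
          (Prod.map (Seq.restrict hk) (Seq.restrict hk)))} := by
    ext P
    rw [mem_realizable_iff hν, Set.mem_iInter₂]
    rfl
  rw [this]
  refine isClosed_iInter fun k => isClosed_iInter fun hk => ?_
  exact CondDist.isClosed_setOf_eq_glue (Seq.measurable_restrict hk)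
    (continuous_pi fun j => continuous_apply _) (ν k)

/-- Nonnegative integrals of functions that are measurable in the first and continuous in the
second variable have closed sublevel sets. -/
theorem CondDist.isClosed_setOf_lintegral_le {α β : Type*}
    [TopologicalSpace α] [PolishSpace α] [MeasurableSpace α] [BorelSpace α]
    [TopologicalSpace β] [PolishSpace β] [CompactSpace β] [MeasurableSpace β] [BorelSpace β]
    {μ : ProbabilityMeasure α} {d : α × β → ℝ≥0} (hm : Measurable d)
    (hc : ∀ x, Continuous fun y => d (x, y)) (D : ℝ≥0∞) :
    IsClosed {P : CondDist μ β | ∫⁻ p, d p ∂(P.joint : Measure (α × β)) ≤ D} := by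
  have hmin (N : ℕ) : Measurable fun p => min (d p) (N : ℝ≥0) := hm.min measurable_const
  -- Monotone convergence along the truncations `min d N`, whose integrals are continuous in `P`.
  have h1 (P : CondDist μ β) : ∫⁻ p, d p ∂(P.joint : Measure (α × β)) =
      ⨆ N : ℕ, ENNReal.ofReal
        (∫ p, ((min (d p) (N : ℝ≥0) : ℝ≥0) : ℝ) ∂(P.joint : Measure (α × β))) := by
    have h2 (p : α × β) : (d p : ℝ≥0∞) = ⨆ N : ℕ, ((min (d p) (N : ℝ≥0) : ℝ≥0) : ℝ≥0∞) := by
      refine le_antisymm ?_ (iSup_le fun N => by exact_mod_cast min_le_left _ _)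
      obtain ⟨N, hN⟩ := exists_nat_ge (d p)
      exact le_iSup_of_le N (by rw [min_eq_left hN])
    simp_rw [h2]
    rw [lintegral_iSup fun N => (hmin N).coe_nnreal_ennreal]
    · refine iSup_congr fun N => ?_
      rw [ofReal_integral_eq_lintegral_ofReal]
      · simp
      · exact Integrable.of_bound (hmin N).coe_nnreal_real.aestronglyMeasurable N
          (ae_of_all _ fun p => by
            rw [Real.norm_eq_abs, NNReal.abs_eq]; exact_mod_cast min_le_right _ _)
      · exact ae_of_all _ fun p => NNReal.coe_nonneg _
    · intro N M hNM p
      have : (N : ℝ≥0) ≤ M := by exact_mod_cast hNM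
      exact ENNReal.coe_le_coe.2 (min_le_min_left _ this)
  simp_rw [h1, iSup_le_iff, Set.ofPred_forall]
  refine isClosed_iInter fun N => isClosed_le (ENNReal.continuous_ofReal.comp ?_) continuous_const
  refine CondDist.continuous_integral (C := N) (hmin N).coe_nnreal_real (fun x => ?_) fun p => ?_
  · exact NNReal.continuous_coe.comp ((hc x).min continuous_const)
  · rw [NNReal.abs_eq]; exact_mod_cast min_le_right _ _

end CausalRDF

theorem lemma2 {X Y : ℕ → Type*}
    [∀ i, TopologicalSpace (X i)] [∀ i, PolishSpace (X i)]
    [∀ i, MeasurableSpace (X i)] [∀ i, BorelSpace (X i)]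
    [∀ i, TopologicalSpace (Y i)] [∀ i, PolishSpace (Y i)]
    [∀ i, MeasurableSpace (Y i)] [∀ i, BorelSpace (Y i)]
    (n : ℕ) [CompactSpace (CausalRDF.Seq Y (n + 1))]
    (μ : ProbabilityMeasure (CausalRDF.Seq X (n + 1))) :
    (IsCompact (Set.univ : Set (CausalRDF.CondDist μ (CausalRDF.Seq Y (n + 1)))) ∧
      IsClosed (CausalRDF.realizable (Y := Y) μ) ∧
      IsCompact (CausalRDF.realizable (Y := Y) μ)) ∧
    ∀ (ρ : (i : Fin (n + 1)) → CausalRDF.Seq X (i + 1) × CausalRDF.Seq Y (i + 1) → ℝ≥0)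
      (D : ℝ≥0),
      (∀ i, Measurable (ρ i)) →
      (∀ x, Continuous (CausalRDF.distortion ρ x)) →
      (∃ x y, CausalRDF.distortion ρ x y < D) →
      CausalRDF.fidelity μ ρ D ⊆ CausalRDF.realizable μ ∧
        IsClosed (CausalRDF.fidelity μ ρ D) ∧
        IsCompact (CausalRDF.fidelity μ ρ D) := by
  have hcomp := CausalRDF.CondDist.isCompact_univ (μ := μ) (β := CausalRDF.Seq Y (n + 1))
  have hclosed := CausalRDF.isClosed_realizable (Y := Y) (μ := μ)
  refine ⟨⟨hcomp, hclosed, hcomp.of_isClosed_subset hclosed (Set.subset_univ _)⟩, ?_⟩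
  intro ρ D hρ hc _
  have hm : Measurable fun p : CausalRDF.Seq X (n + 1) × CausalRDF.Seq Y (n + 1) =>
      CausalRDF.distortion ρ p.1 p.2 :=
    Finset.measurable_sum _ fun i _ => (hρ i).comp
      (((CausalRDF.Seq.measurable_restrict _).comp measurable_fst).prodMk
        ((CausalRDF.Seq.measurable_restrict _).comp measurable_snd))
  have hfid : IsClosed (CausalRDF.fidelity μ ρ D) :=
    (CausalRDF.CondDist.isClosed_setOf_lintegral_le hm hc D).inter hclosed
  exact ⟨Set.inter_subset_right, hfid, hcomp.of_isClosed_subset hfid (Set.subset_univ _)⟩
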